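/- Let $\Xi=\{x_1,\dots,x_n\}$ be a set of $n$ unknowns and $\Sigma$ an alphabet. A word equation $E$ on $n$ unknowns is a pair $u=v$ of words $u,v\in\Xi^*$; it is nontrivial if $u$ and $v$ are different words, and its length is $|E|=|uv|$. A solution of $E$ is a morphism $h:\Xi^*\to\Sigma^*$ with $h(u)=h(v)$. The rank of a morphism $h$ is the smallest $r$ for which there is a set $A$ of $r$ words over $\Sigma$ with $h(x)\in A^*$ for every $x\in\Xi$, and the length type of $h$ is the vector $(|h(x_1)|,\dots,|h(x_n)|)\in\mathbb{Q}^n$. Let $m\ge 1$ and let $E_1,\dots,E_m$ be nontrivial equations on $n$ unknowns having a common solution of rank $n-1$. Assume that for every $i\in\{1,\dots,m-1\}$ there is a solution of the system $E_1,\dots,E_i$ of rank $n-1$ that is not a solution of $E_{i+1}$. If $m\ge 2$ and the length types of the rank-$(n-1)$ common solutions of the pair $E_1,E_2$ are covered by a union of $N$ $(n-1)$-dimensional linear subspaces of $\mathbb{Q}^n$, then $m\le N+1$. In general (without any assumption on such a cover), $m\le |E_1|^2+1$. -/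

import Mathlib

namespace WordEq

/-- A (coefficient-free) word equation `lhs = rhs` on the `n` unknowns `Fin n`. -/
structure Equation (n : ℕ) where
  lhs : FreeMonoid (Fin n)
  rhs : FreeMonoid (Fin n)

/-- An equation is trivial if both sides are the same word. -/
def Equation.IsTrivial {n : ℕ} (E : Equation n) : Prop :=
  E.lhs = E.rhs

/-- The length of the equation `u = v` is the length of the word `uv`. -/
def Equation.length {n : ℕ} (E : Equation n) : ℕ :=
  (E.lhs * E.rhs).length

/-- A morphism from words over the unknowns to words over `α` solves `u = v` if it maps
`u` and `v` to the same word. -/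
def Equation.IsSolution {n : ℕ} {α : Type*} (E : Equation n)
    (h : FreeMonoid (Fin n) →* FreeMonoid α) : Prop :=
  h E.lhs = h E.rhs

/-- The combinatorial rank of a morphism `h`: the least `r` for which there is a set `A` of
`r` words such that `h x ∈ A*` for every unknown `x`. -/
noncomputable def rank {n : ℕ} {α : Type*} (h : FreeMonoid (Fin n) →* FreeMonoid α) : ℕ :=
  sInf {r : ℕ | ∃ A : Finset (FreeMonoid α), A.card = r ∧
    ∀ x : Fin n, h (FreeMonoid.of x) ∈ Submonoid.closure (A : Set (FreeMonoid α))}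

/-- The minimum in the definition of the rank is attained. -/
theorem exists_card_eq_rank {n : ℕ} {α : Type*} (h : FreeMonoid (Fin n) →* FreeMonoid α) :
    ∃ A : Finset (FreeMonoid α), A.card = rank h ∧
      ∀ x : Fin n, h (FreeMonoid.of x) ∈ Submonoid.closure (A : Set (FreeMonoid α)) := by
  classical
  have hne : {r : ℕ | ∃ A : Finset (FreeMonoid α), A.card = r ∧
      ∀ x : Fin n, h (FreeMonoid.of x) ∈
        Submonoid.closure (A : Set (FreeMonoid α))}.Nonempty :=
    ⟨_, Finset.univ.image (fun x : Fin n => h (FreeMonoid.of x)), rfl, fun x =>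
      Submonoid.subset_closure (by simp)⟩
  exact Nat.sInf_mem hne

/-- The length type `(|h(x₁)|, …, |h(xₙ)|)` of a morphism, as a vector of `ℚⁿ`. -/
def lengthType {n : ℕ} {α : Type*} (h : FreeMonoid (Fin n) →* FreeMonoid α) : Fin n → ℚ :=
  fun x => ((h (FreeMonoid.of x)).length : ℚ)

end WordEq

/-!
The argument works with abelianized Fox derivatives of words.

**Reduction to full morphisms.** A solution `h` of rank `n - 1` of a nontrivial equation factors as
`h = θ ∘ φ`, where `φ` takes values in words over `n - 1` letters and the Parikh vectors of the
words `φ x` span `ℚⁿ⁻¹` (`exists_factor`, by Nielsen substitutions). By maximality of the rank, `θ`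
is injective, so `φ` solves exactly the equations that `h` solves (`exists_full_equivalent`). The
abelianization of `φ` has a one-dimensional kernel, and the lengths compatible with `φ` form the
hyperplane orthogonal to it.

**The kernel decides.** The chain rule says that `φ` solves `E` if and only if the Jacobian of `φ`
kills the vector of differences of the Fox derivatives of the two sides of `E`, taken with exponents
in the image of the abelianization. The Jacobian has corank one, so the vectors of two equations
solved by `φ` are parallel (`foxDiff_parallel`), and these vectors depend only on the kernel of the
abelianization. Moreover, the vector of a nontrivial equation does not vanish
(`foxDiff_imageWeight_ne_zero`). Hence if `φ` and `φ'` solve `E₁`, have the same kernel, and `φ'`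
solves `F`, then `φ` solves `F` (`isSolution_of_abel`). The solutions in the chain of the theorem
therefore have pairwise different kernels.

**The bound by a cover.** Composing `φ` with morphisms sending letters to powers of distinct letters
gives solutions of rank `n - 1` for all positive integer lengths of the letters. If finitely many
hyperplanes cover the length types, then the hyperplane of `φ` is one of them
(`exists_range_lengthMap_eq`). All solutions in the chain except the first one solve both `E₁` and
`E₂`, and their hyperplanes are different, so `m - 1 ≤ N`.

**The bound by the length.** Some `2 × 2` minor `M` of the generic Fox derivatives of `E₁` and `E₂`
is a nonzero polynomial, as the first solution in the chain does not solve `E₂`, but `M` vanishes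
under all later ones. An exponent of `M` is the sum of the Parikh vectors of a prefix of a side of
`E₁` and of a prefix of a side of `E₂`, and the prefixes of one word form a chain; so the exponents
of either sign are covered by `|E₁|` chains (`exists_mem_minorChain`). Each later solution `φ` singles
out an exponent with positive and one with negative coefficient which it identifies, both of them
minimal in a suitable sense, and a chain contains at most one minimal exponent, whatever the solution
(`IsExtremal.eq_of_le`). The pair of exponents determines the kernel, so `m - 1 ≤ |E₁| ^ 2`.
-/

namespace WordEq

open FreeMonoid

/-! ### Parikh vectors -/

/-- The Parikh vector of a word: the number of occurrences of each letter. -/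
noncomputable def parikh {Y : Type*} (w : FreeMonoid Y) : Y →₀ ℕ :=
  (w.toList.map fun y => Finsupp.single y 1).sum

@[simp] theorem parikh_one {Y : Type*} : parikh (1 : FreeMonoid Y) = 0 := rfl

@[simp] theorem parikh_of {Y : Type*} (y : Y) : parikh (of y) = Finsupp.single y 1 := by
  simp [parikh]

@[simp] theorem parikh_mul {Y : Type*} (v w : FreeMonoid Y) :
    parikh (v * w) = parikh v + parikh w := by
  simp [parikh]

/-- The Parikh vector with rational entries, for use in linear algebra. -/
noncomputable def parikhQ {Y : Type*} (w : FreeMonoid Y) : Y → ℚ := fun y => (parikh w y : ℚ)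

@[simp] theorem parikhQ_one {Y : Type*} : parikhQ (1 : FreeMonoid Y) = 0 := by
  ext; simp [parikhQ]

@[simp] theorem parikhQ_mul {Y : Type*} (v w : FreeMonoid Y) :
    parikhQ (v * w) = parikhQ v + parikhQ w := by
  ext; simp [parikhQ]

/-- A morphism is *full* if the Parikh vectors of the images of the letters span the whole
space, that is, if its abelianization has maximal rank. -/
def IsFull {X Y : Type*} (φ : FreeMonoid X →* FreeMonoid Y) : Prop :=
  Submodule.span ℚ (Set.range fun x => parikhQ (φ (of x))) = ⊤

/-! ### Factoring a non-injective morphism through a smaller alphabet -/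

/-- The elementary Nielsen substitution `b ↦ ab`, fixing all other letters. -/
def nielsen {X : Type*} [DecidableEq X] (a b : X) : FreeMonoid X →* FreeMonoid X :=
  lift fun x => if x = b then of a * of b else of x

theorem nielsen_of_self {X : Type*} [DecidableEq X] (a b : X) :
    nielsen a b (of b) = of a * of b := by
  simp [nielsen]

theorem nielsen_of_ne {X : Type*} [DecidableEq X] (a : X) {b x : X} (h : x ≠ b) :
    nielsen a b (of x) = of x := by
  simp [nielsen, h]

/-- The image of each letter under the substitution ends in that letter, so an image can be
decoded from its right end. -/
theorem nielsen_injective {X : Type*} [DecidableEq X] (a b : X) :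
    Function.Injective (nielsen a b) := by
  have key : ∀ x : X, ∃ p : FreeMonoid X, nielsen a b (of x) = p * of x := by
    intro x
    by_cases h : x = b
    · subst h; exact ⟨of a, nielsen_of_self _ _⟩
    · exact ⟨1, by rw [nielsen_of_ne a h, one_mul]⟩
  have hlast : ∀ (p q : FreeMonoid X) (c d : X), p * of c = q * of d → p = q ∧ c = d := by
    intro p q c d h
    have h' := congrArg toList h
    simp only [toList_mul, toList_of] at h'
    have := List.append_inj' h' rfl
    exact ⟨toList.injective this.1, by simpa using this.2⟩
  have hone : ∀ (u : FreeMonoid X) (c : X), nielsen a b (u * of c) ≠ 1 := by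
    intro u c h
    obtain ⟨p, hp⟩ := key c
    have := congrArg FreeMonoid.length h
    rw [map_mul, hp] at this
    simp at this
  have main : ∀ l l' : List X, nielsen a b (ofList l) = nielsen a b (ofList l') → l = l' := by
    intro l
    induction l using List.reverseRecOn with
    | nil =>
      intro l' h
      rcases List.eq_nil_or_concat l' with rfl | ⟨l'', d, rfl⟩
      · rfl
      · exact absurd h.symm (by simpa using hone (ofList l'') d)
    | append_singleton l c ih =>
      intro l' h
      rcases List.eq_nil_or_concat l' with rfl | ⟨l'', d, rfl⟩
      · exact absurd h (by simpa using hone (ofList l) c)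
      · simp only [ofList_append, ofList_singleton, map_mul, List.concat_eq_append] at h
        obtain ⟨p, hp⟩ := key c
        obtain ⟨q, hq⟩ := key d
        rw [hp, hq, ← mul_assoc, ← mul_assoc] at h
        obtain ⟨h1, rfl⟩ := hlast _ _ _ _ h
        rw [hp] at hq
        obtain ⟨rfl, -⟩ := hlast _ _ _ _ hq
        rw [ih l'' (mul_right_cancel h1)]
        simp
  intro u v h
  exact toList.injective (main u.toList v.toList (by simpa using h))

theorem mul_eq_mul_cases {α : Type*} {p q r s : FreeMonoid α} (h : p * q = r * s) :
    (∃ w, r = p * w) ∨ ∃ w, p = r * w := by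
  have h' := congrArg toList h
  simp only [toList_mul] at h'
  rcases List.append_eq_append_iff.1 h' with ⟨w, hw, -⟩ | ⟨w, hw, -⟩
  · exact Or.inl ⟨ofList w, toList.injective (by simpa using hw)⟩
  · exact Or.inr ⟨ofList w, toList.injective (by simpa using hw)⟩

theorem IsFull.comp_nielsen {X Y : Type*} [DecidableEq X] {φ : FreeMonoid X →* FreeMonoid Y}
    (hφ : IsFull φ) {a b : X} (hab : a ≠ b) : IsFull (φ.comp (nielsen a b)) := by
  rw [IsFull, eq_top_iff, ← hφ, Submodule.span_le]
  have hne : ∀ x, x ≠ b → parikhQ (φ (of x)) ∈ Submodule.span ℚ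
      (Set.range fun x => parikhQ ((φ.comp (nielsen a b)) (of x))) := by
    intro x hx
    refine Submodule.subset_span ⟨x, ?_⟩
    simp [nielsen_of_ne a hx]
  rintro _ ⟨x, rfl⟩
  by_cases hx : x = b
  · subst hx
    have h1 : parikhQ ((φ.comp (nielsen a x)) (of x)) ∈ Submodule.span ℚ
        (Set.range fun x' => parikhQ ((φ.comp (nielsen a x)) (of x'))) :=
      Submodule.subset_span ⟨x, rfl⟩
    have h2 := Submodule.sub_mem _ h1 (hne a hab)
    simpa [nielsen_of_self] using h2
  · exact hne x hx

/-- Deleting a letter with empty image. -/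
theorem exists_factor_of_eq_one {X Y α : Type*} [Fintype X] [Fintype Y]
    (hc : Fintype.card Y + 1 = Fintype.card X) (h : FreeMonoid X →* FreeMonoid α) (b : X)
    (hb : h (of b) = 1) :
    ∃ (φ : FreeMonoid X →* FreeMonoid Y) (θ : FreeMonoid Y →* FreeMonoid α),
      h = θ.comp φ ∧ IsFull φ := by
  classical
  have hcard : Fintype.card {x : X // x ≠ b} = Fintype.card Y := by
    rw [Fintype.card_subtype_compl, Fintype.card_subtype_eq]; omega
  let e : {x : X // x ≠ b} ≃ Y := Fintype.equivOfCardEq hcard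
  refine ⟨lift fun x => if hx : x = b then 1 else of (e ⟨x, hx⟩),
    lift fun y => h (of (e.symm y).1), ?_, ?_⟩
  · refine hom_eq fun x => ?_
    by_cases hx : x = b
    · subst hx; simp [hb]
    · simp [hx]
  · rw [IsFull, eq_top_iff, ← (Pi.basisFun ℚ Y).span_eq, Submodule.span_le]
    rintro _ ⟨y, rfl⟩
    refine Submodule.subset_span ⟨(e.symm y).1, ?_⟩
    have : (e.symm y).1 ≠ b := (e.symm y).2
    ext z
    simp [this, parikhQ, Finsupp.single_apply, Pi.single_apply, eq_comm (a := y)]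

/-- A morphism that identifies two distinct words factors through an alphabet with one letter
fewer, by a full morphism. The factorization is found by Nielsen substitutions `b ↦ ab`, each of
which shortens the images, until some letter has empty image and can be deleted. -/
theorem exists_factor {X Y α : Type*} [Fintype X] [Fintype Y]
    (hc : Fintype.card Y + 1 = Fintype.card X) (h : FreeMonoid X →* FreeMonoid α)
    {u v : FreeMonoid X} (huv : u ≠ v) (heq : h u = h v) :
    ∃ (φ : FreeMonoid X →* FreeMonoid Y) (θ : FreeMonoid Y →* FreeMonoid α),
      h = θ.comp φ ∧ IsFull φ := by
  classical
  induction hN : ∑ x, (h (of x)).length using Nat.strong_induction_on generalizing h u v with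
  | _ N ih =>
  -- the Nielsen step, once the first letters `a ≠ b` are known
  have step : ∀ (a b : X) (w : FreeMonoid α), a ≠ b → h (of b) = h (of a) * w →
      h (of a) ≠ 1 → ∃ (φ : FreeMonoid X →* FreeMonoid Y) (θ : FreeMonoid Y →* FreeMonoid α),
      h = θ.comp φ ∧ IsFull φ := by
    intro a b w hab hb ha
    let h' : FreeMonoid X →* FreeMonoid α := lift fun x => if x = b then w else h (of x)
    have hb' : h' (of b) = w := by simp [h']
    have hx' : ∀ x, x ≠ b → h' (of x) = h (of x) := fun x hx => by simp [h', hx]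
    have hh : h = h'.comp (nielsen a b) := by
      refine hom_eq fun x => ?_
      by_cases hx : x = b
      · subst hx
        simp [nielsen_of_self, hb', hx' a hab, hb]
      · simp [nielsen_of_ne a hx, hx' x hx]
    have hlt : ∑ x, (h' (of x)).length < N := by
      rw [← hN]
      refine Finset.sum_lt_sum (fun x _ => ?_) ⟨b, Finset.mem_univ _, ?_⟩
      · by_cases hx : x = b
        · subst hx; rw [hb', hb, length_mul]; omega
        · rw [hx' x hx]
      · rw [hb', hb, length_mul]
        have := mt length_eq_zero.1 ha
        omega
    obtain ⟨φ, θ, hφθ, hfull⟩ := ih _ hlt h' (u := nielsen a b u) (v := nielsen a b v)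
      (fun H => huv (nielsen_injective a b H)) (by
        have := heq
        rw [hh] at this
        exact this) rfl
    refine ⟨φ.comp (nielsen a b), θ, ?_, hfull.comp_nielsen hab⟩
    rw [hh, hφθ, MonoidHom.comp_assoc]
  clear ih
  induction u using FreeMonoid.inductionOn' generalizing v with
  | one =>
    induction v using FreeMonoid.inductionOn' with
    | one => exact absurd rfl huv
    | of_mul b v _ =>
      refine exists_factor_of_eq_one hc h b ?_
      rw [← length_eq_zero]
      have := congrArg FreeMonoid.length heq
      rw [map_one, map_mul, length_one, length_mul] at this
      omega
  | of_mul a u ihu =>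
    induction v using FreeMonoid.inductionOn' with
    | one =>
      refine exists_factor_of_eq_one hc h a ?_
      rw [← length_eq_zero]
      have := congrArg FreeMonoid.length heq
      rw [map_one, map_mul, length_one, length_mul] at this
      omega
    | of_mul b v _ =>
      by_cases hab : a = b
      · subst hab
        rw [map_mul, map_mul] at heq
        exact ihu (fun H => huv (by rw [H])) (mul_left_cancel heq)
      · by_cases ha : h (of a) = 1
        · exact exists_factor_of_eq_one hc h a ha
        by_cases hb : h (of b) = 1
        · exact exists_factor_of_eq_one hc h b hb
        rw [map_mul, map_mul] at heq
        rcases mul_eq_mul_cases heq with ⟨w, hw⟩ | ⟨w, hw⟩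
        · exact step a b w hab hw ha
        · exact step b a w (Ne.symm hab) hw hb

/-! ### Solutions of corank one -/

theorem rank_comp_le {n : ℕ} {Y α : Type*} [Fintype Y] (φ : FreeMonoid (Fin n) →* FreeMonoid Y)
    (θ : FreeMonoid Y →* FreeMonoid α) : rank (θ.comp φ) ≤ Fintype.card Y := by
  classical
  have hle : rank (θ.comp φ) ≤ (Finset.univ.image fun y => θ (of y)).card := by
    refine Nat.sInf_le ⟨_, rfl, fun x => ?_⟩
    rw [MonoidHom.comp_apply]
    induction φ (of x) using FreeMonoid.inductionOn' with
    | one => rw [map_one]; exact Submonoid.one_mem _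
    | of_mul y w ih =>
      rw [map_mul]
      exact Submonoid.mul_mem _ (Submonoid.subset_closure (by simp)) ih
  exact hle.trans Finset.card_image_le

/-- If `θ ∘ φ` has the largest rank that the size of the intermediate alphabet permits, then `θ`
is injective: otherwise `θ` would factor through a smaller alphabet. -/
theorem injective_of_rank_comp {n k : ℕ} {α : Type*} {φ : FreeMonoid (Fin n) →* FreeMonoid (Fin k)}
    {θ : FreeMonoid (Fin k) →* FreeMonoid α} (hr : rank (θ.comp φ) = k) :
    Function.Injective θ := by
  intro u v huv
  by_contra hne
  cases k with
  | zero => exact hne (Subsingleton.elim u v)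
  | succ k =>
    obtain ⟨φ', θ', hθ, -⟩ := exists_factor (Y := Fin k) (by simp) θ hne huv
    have := rank_comp_le (φ'.comp φ) θ'
    rw [← MonoidHom.comp_assoc, ← hθ, hr, Fintype.card_fin] at this
    omega

/-- A solution of rank `k` of a nontrivial equation on `k + 1` unknowns factors through a full
morphism to words over `k` letters which solves exactly the same equations. -/
theorem exists_full_equivalent {k : ℕ} {α : Type*} {h : FreeMonoid (Fin (k + 1)) →* FreeMonoid α}
    (hr : rank h = k) {E : Equation (k + 1)} (hE : ¬ E.IsTrivial) (hs : E.IsSolution h) :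
    ∃ φ : FreeMonoid (Fin (k + 1)) →* FreeMonoid (Fin k), IsFull φ ∧
      ∀ F : Equation (k + 1), F.IsSolution φ ↔ F.IsSolution h := by
  obtain ⟨φ, θ, rfl, hφ⟩ := exists_factor (Y := Fin k) (by simp) h hE hs
  exact ⟨φ, hφ, fun F => (injective_of_rank_comp hr).eq_iff.symm⟩

/-- The rank is at most the number of letters. -/
theorem exists_embedding_of_rank {n k : ℕ} {α : Type*} {h : FreeMonoid (Fin n) →* FreeMonoid α}
    (hr : rank h = k) : Nonempty (Fin k ↪ α) := by
  rcases finite_or_infinite α with hα | hα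
  · have := Fintype.ofFinite α
    refine Function.Embedding.nonempty_of_card_le ?_
    have := rank_comp_le h (MonoidHom.id (FreeMonoid α))
    rwa [MonoidHom.id_comp, hr, ← Fintype.card_fin k] at this
  · exact ⟨(Fin.valEmbedding).trans (Infinite.natEmbedding α)⟩

/-- The morphism sending the letter `y` to the power `(a y) ^ ℓ y` of a letter. -/
def powers {k : ℕ} {α : Type*} (a : Fin k → α) (ℓ : Fin k → ℕ) :
    FreeMonoid (Fin k) →* FreeMonoid α :=
  lift fun y => of (a y) ^ ℓ y

theorem parikh_powers {k : ℕ} {α : Type*} {a : Fin k → α} (ha : Function.Injective a)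
    (ℓ : Fin k → ℕ) (w : FreeMonoid (Fin k)) (y : Fin k) :
    parikh (powers a ℓ w) (a y) = parikh w y * ℓ y := by
  classical
  have hpow : ∀ (b : α) (c : ℕ), parikh (of b ^ c) = Finsupp.single b c := by
    intro b c
    induction c with
    | zero => simp
    | succ c ih => rw [pow_succ, parikh_mul, ih, parikh_of, ← Finsupp.single_add]
  induction w using FreeMonoid.inductionOn' with
  | one => simp
  | of_mul z w ih =>
    rw [map_mul, parikh_mul, parikh_mul, Finsupp.add_apply, Finsupp.add_apply, ih, add_mul]
    congr 1
    simp only [powers, lift_eval_of, hpow, parikh_of, Finsupp.single_apply, ha.eq_iff]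
    split_ifs with h
    · rw [h, one_mul]
    · rw [zero_mul]

/-- Linear independence of Parikh vectors bounds the rank from below, whatever the exponents. -/
theorem rank_powers_comp {n k : ℕ} {α : Type*} {φ : FreeMonoid (Fin n) →* FreeMonoid (Fin k)}
    (hφ : IsFull φ) {a : Fin k → α} (ha : Function.Injective a) {ℓ : Fin k → ℕ}
    (hℓ : ∀ y, 0 < ℓ y) : rank ((powers a ℓ).comp φ) = k := by
  classical
  refine le_antisymm (by simpa using rank_comp_le φ (powers a ℓ)) ?_
  obtain ⟨A, hA, hmem⟩ := exists_card_eq_rank ((powers a ℓ).comp φ)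
  rw [← hA]
  let π : FreeMonoid α → (Fin k → ℚ) := fun w y => (parikh w (a y) : ℚ) / ℓ y
  have hspan : ∀ w ∈ Submonoid.closure (A : Set (FreeMonoid α)),
      π w ∈ Submodule.span ℚ ((A.image π : Finset (Fin k → ℚ)) : Set (Fin k → ℚ)) := by
    intro w hw
    induction hw using Submonoid.closure_induction with
    | mem w hw => exact Submodule.subset_span (by simpa using ⟨w, hw, rfl⟩)
    | one =>
      have : π 1 = 0 := by ext; simp [π]
      rw [this]; exact Submodule.zero_mem _
    | mul v w _ _ hv hw =>
      have : π (v * w) = π v + π w := by ext; simp [π, add_div]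
      rw [this]; exact Submodule.add_mem _ hv hw
  have hπ : ∀ x, π ((powers a ℓ).comp φ (of x)) = parikhQ (φ (of x)) := by
    intro x
    ext y
    have : (ℓ y : ℚ) ≠ 0 := by exact_mod_cast (hℓ y).ne'
    simp only [π, MonoidHom.comp_apply, parikh_powers ha, parikhQ]
    push_cast
    field_simp
  have htop : Submodule.span ℚ ((A.image π : Finset (Fin k → ℚ)) : Set (Fin k → ℚ)) = ⊤ := by
    rw [eq_top_iff, ← hφ, Submodule.span_le]
    rintro _ ⟨x, rfl⟩
    rw [SetLike.mem_coe]
    dsimp only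
    rw [← hπ x]
    exact hspan _ (hmem x)
  have h1 := finrank_span_finset_le_card (R := ℚ) (A.image π)
  rw [Set.finrank, htop, finrank_top, Module.finrank_fin_fun] at h1
  exact h1.trans Finset.card_image_le

/-- The linear map taking the lengths of the letters `y` to the lengths of the words `φ x`. -/
noncomputable def lengthMap {X Y : Type*} [Fintype Y] (φ : FreeMonoid X →* FreeMonoid Y) :
    (Y → ℚ) →ₗ[ℚ] (X → ℚ) :=
  Matrix.mulVecLin (Matrix.of fun x y => parikhQ (φ (of x)) y)

theorem lengthMap_apply {X Y : Type*} [Fintype Y] (φ : FreeMonoid X →* FreeMonoid Y)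
    (ℓ : Y → ℚ) (x : X) : lengthMap φ ℓ x = ∑ y, parikhQ (φ (of x)) y * ℓ y := rfl

theorem lengthMap_injective {X Y : Type*} [Fintype Y] {φ : FreeMonoid X →* FreeMonoid Y}
    (hφ : IsFull φ) : Function.Injective (lengthMap φ) := by
  classical
  rw [injective_iff_map_eq_zero]
  intro ℓ h
  have key : ∀ v ∈ (⊤ : Submodule ℚ (Y → ℚ)), ∑ y, v y * ℓ y = 0 := by
    intro v hv
    rw [← hφ] at hv
    induction hv using Submodule.span_induction with
    | mem v hv =>
      obtain ⟨x, rfl⟩ := hv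
      exact congrFun h x
    | zero => simp
    | add v w _ _ hv hw => simp [add_mul, Finset.sum_add_distrib, hv, hw]
    | smul c v _ hv => simp [mul_assoc, ← Finset.mul_sum, hv]
  ext y
  simpa [Pi.single_apply] using key (Pi.single y 1) trivial

theorem length_powers {k : ℕ} {α : Type*} (a : Fin k → α) (ℓ : Fin k → ℕ)
    (w : FreeMonoid (Fin k)) :
    ((powers a ℓ w).length : ℚ) = ∑ y, parikhQ w y * ℓ y := by
  have hpow : ∀ (b : α) (c : ℕ), (of b ^ c).length = c := by
    intro b c
    induction c with
    | zero => simp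
    | succ c ih => rw [pow_succ, length_mul, ih, length_of]
  induction w using FreeMonoid.inductionOn' with
  | one => simp
  | of_mul z w ih =>
    rw [map_mul, length_mul, Nat.cast_add, ih, parikhQ_mul]
    simp only [Pi.add_apply, add_mul, Finset.sum_add_distrib]
    congr 1
    simp [powers, hpow, parikhQ, Finsupp.single_apply]

theorem lengthType_powers_comp {n k : ℕ} {α : Type*} (φ : FreeMonoid (Fin n) →* FreeMonoid (Fin k))
    (a : Fin k → α) (ℓ : Fin k → ℕ) :
    lengthType ((powers a ℓ).comp φ) = lengthMap φ fun y => (ℓ y : ℚ) := by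
  ext x
  rw [lengthMap_apply, ← length_powers a]
  rfl

/-- Finitely many subspaces that together contain all positive integer points include the whole
space. -/
theorem exists_eq_top_of_forall_pos {k N : ℕ} (W : Fin N → Submodule ℚ (Fin k → ℚ))
    (hW : ∀ ℓ : Fin k → ℕ, (∀ y, 0 < ℓ y) → ∃ i, (fun y => (ℓ y : ℚ)) ∈ W i) :
    ∃ i, W i = ⊤ := by
  refine Subspace.exists_eq_top_of_iUnion_eq_univ (Set.eq_univ_of_forall fun v => ?_)
  -- far out on the line through `v` in the direction `(1, …, 1)` all points are positive
  obtain ⟨T, hT⟩ : ∃ T : ℕ, ∀ y, 0 < v y + T := by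
    obtain ⟨T, hT⟩ := exists_nat_gt (∑ y, |v y|)
    refine ⟨T, fun y => ?_⟩
    have h1 := Finset.single_le_sum (f := fun y => |v y|) (fun _ _ => abs_nonneg _)
      (Finset.mem_univ y)
    have h2 := neg_abs_le (v y)
    linarith
  have hline : ∀ t : ℕ, ∃ i, (fun y => v y + (T + t : ℕ)) ∈ W i := by
    intro t
    let D : ℕ := ∏ y, (v y).den
    have hD : 0 < D := Finset.prod_pos fun y _ => (v y).den_pos
    have hint : ∀ y, ∃ c : ℕ, (c : ℚ) = D * (v y + (T + t : ℕ)) := by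
      intro y
      obtain ⟨d, hd⟩ : (v y).den ∣ D := Finset.dvd_prod_of_mem _ (Finset.mem_univ y)
      have h1 : (D : ℚ) * (v y + (T + t : ℕ)) = ((d * (v y).num + D * (T + t : ℕ) : ℤ) : ℚ) := by
        have h2 : (D : ℚ) * v y = d * (v y).num := by
          rw [hd]; push_cast
          rw [mul_comm ((v y).den : ℚ), mul_assoc, Rat.den_mul_eq_num]
        rw [mul_add, h2]
        push_cast
        ring
      have h3 : 0 ≤ (d * (v y).num + D * (T + t : ℕ) : ℤ) := by
        have : (0 : ℚ) ≤ D * (v y + (T + t : ℕ)) := by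
          have := hT y
          push_cast
          have : (0 : ℚ) ≤ t := t.cast_nonneg
          apply mul_nonneg <;> [positivity; linarith]
        rw [h1] at this
        exact_mod_cast this
      refine ⟨(d * (v y).num + D * (T + t : ℕ) : ℤ).toNat, ?_⟩
      rw [h1, ← Int.cast_natCast, Int.toNat_of_nonneg h3]
    choose c hc using hint
    obtain ⟨i, hi⟩ := hW c (fun y => by
      have h1 : (0 : ℚ) < c y := by
        rw [hc]
        have := hT y
        have h2 : (0 : ℚ) ≤ t := t.cast_nonneg
        push_cast
        apply mul_pos <;> [exact_mod_cast hD; linarith]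
      exact_mod_cast h1)
    refine ⟨i, ?_⟩
    have h1 := Submodule.smul_mem (W i) (D : ℚ)⁻¹ hi
    convert h1 using 1
    ext y
    have : (D : ℚ) ≠ 0 := by exact_mod_cast hD.ne'
    simp only [Pi.smul_apply, smul_eq_mul, hc]
    field_simp
  -- so one subspace contains two points of this line, hence the line and `v`
  choose i hi using hline
  obtain ⟨s, t, hst, his⟩ := Finite.exists_ne_map_eq_of_infinite i
  have h1 := hi s
  have h2 := hi t
  rw [← his] at h2
  have hone : (fun _ => (1 : ℚ)) ∈ W (i s) := by
    have h3 := Submodule.smul_mem _ ((s : ℚ) - t)⁻¹ (Submodule.sub_mem _ h1 h2)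
    convert h3 using 1
    ext y
    have : (s : ℚ) - t ≠ 0 := sub_ne_zero.2 (by exact_mod_cast hst)
    simp only [Pi.smul_apply, Pi.sub_apply, smul_eq_mul]
    push_cast
    rw [add_sub_add_left_eq_sub, add_sub_add_left_eq_sub, inv_mul_cancel₀ this]
  refine Set.mem_iUnion.2 ⟨i s, ?_⟩
  have h3 := Submodule.sub_mem _ h1 (Submodule.smul_mem _ ((T + s : ℕ) : ℚ) hone)
  have h4 : (fun y => v y + ((T + s : ℕ) : ℚ)) - ((T + s : ℕ) : ℚ) • (fun _ => (1 : ℚ)) = v := by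
    ext y; simp
  rwa [h4] at h3

/-- If finitely many hyperplanes cover the length types of the rank `k` solutions of a system, then
one of them is the space of all lengths compatible with a given full solution. -/
theorem exists_range_lengthMap_eq {k N : ℕ} {α : Type*}
    {φ : FreeMonoid (Fin (k + 1)) →* FreeMonoid (Fin k)} (hφ : IsFull φ) {a : Fin k → α}
    (ha : Function.Injective a) (V : Fin N → Submodule ℚ (Fin (k + 1) → ℚ))
    (hV : ∀ i, Module.finrank ℚ (V i) = k)
    (hcover : ∀ θ : FreeMonoid (Fin k) →* FreeMonoid α, rank (θ.comp φ) = k →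
      ∃ i, lengthType (θ.comp φ) ∈ V i) :
    ∃ i, LinearMap.range (lengthMap φ) = V i := by
  obtain ⟨i, hi⟩ := exists_eq_top_of_forall_pos (fun i => (V i).comap (lengthMap φ)) (by
    intro ℓ hℓ
    obtain ⟨i, hi⟩ := hcover _ (rank_powers_comp hφ ha hℓ)
    refine ⟨i, ?_⟩
    rwa [lengthType_powers_comp] at hi)
  refine ⟨i, Submodule.eq_of_le_of_finrank_eq ?_ ?_⟩
  · rintro _ ⟨ℓ, rfl⟩
    have : ℓ ∈ (V i).comap (lengthMap φ) := by rw [hi]; trivial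
    exact this
  · rw [LinearMap.finrank_range_of_inj (lengthMap_injective hφ), hV, Module.finrank_fin_fun]

/-! ### Abelianized Fox derivatives -/

theorem lift_X {Y : Type*} (w : FreeMonoid Y) :
    lift (MvPolynomial.X : Y → MvPolynomial Y ℤ) w = MvPolynomial.monomial (parikh w) 1 := by
  induction w using FreeMonoid.inductionOn' with
  | one => simp
  | of_mul a w ih =>
    rw [map_mul, ih, lift_eval_of, parikh_mul, parikh_of, MvPolynomial.X,
      MvPolynomial.monomial_mul, one_mul]

section Fox

variable {X Y R S : Type*} [DecidableEq X] [DecidableEq Y] [CommRing R] [CommRing S]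

/-- Recursive form of the Fox derivative on lists. -/
def foxAux (t : X → R) (x : X) : List X → R
  | [] => 0
  | a :: l => (if a = x then 1 else 0) + t a * foxAux t x l

/-- The abelianized Fox derivative of the word `u` with respect to the letter `x`: the sum, over
all occurrences of `x` in `u`, of the weight of the prefix before the occurrence, where the letter
`a` has weight `t a` in a commutative ring. -/
def fox (t : X → R) (u : FreeMonoid X) (x : X) : R := foxAux t x u.toList

@[simp] theorem fox_one (t : X → R) (x : X) : fox t 1 x = 0 := rfl

theorem fox_of_mul (t : X → R) (a : X) (u : FreeMonoid X) (x : X) :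
    fox t (of a * u) x = (if a = x then 1 else 0) + t a * fox t u x := rfl

theorem fox_mul (t : X → R) (u v : FreeMonoid X) (x : X) :
    fox t (u * v) x = fox t u x + lift t u * fox t v x := by
  induction u using FreeMonoid.inductionOn' with
  | one => simp
  | of_mul a u ih =>
    rw [mul_assoc, fox_of_mul, ih, fox_of_mul, map_mul, lift_eval_of]
    ring

theorem map_fox (f : R →+* S) (t : X → R) (u : FreeMonoid X) (x : X) :
    f (fox t u x) = fox (fun a => f (t a)) u x := by
  induction u using FreeMonoid.inductionOn' with
  | one => simp
  | of_mul a u ih =>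
    rw [fox_of_mul, fox_of_mul, map_add, map_mul, ih]
    split_ifs <;> simp

/-- The chain rule. -/
theorem fox_map [Fintype X] (t : Y → R) (φ : FreeMonoid X →* FreeMonoid Y) (u : FreeMonoid X)
    (y : Y) :
    fox t (φ u) y = ∑ x, fox (fun a => lift t (φ (of a))) u x * fox t (φ (of x)) y := by
  induction u using FreeMonoid.inductionOn' with
  | one => simp
  | of_mul a u ih =>
    simp only [fox_of_mul, add_mul, Finset.sum_add_distrib, mul_assoc, ← Finset.mul_sum]
    rw [map_mul, fox_mul, ih]
    simp

/-- The Fox derivatives determine the word. The ring homomorphism `c` plays the role of the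
constant coefficient, so `c (t a) = 0` says that the weight of `a` is a nontrivial monomial; this
may fail for a single letter. At the first difference `a ≠ b` of two words, the derivative with
respect to the other one of these letters distinguishes the words. -/
theorem eq_of_fox_eq [IsDomain R] (c : R →+* ℤ) {t : X → R} (ht : ∀ x, t x ≠ 0)
    (hc : ∀ x, 0 ≤ c (t x)) (hc' : ∀ a b, a ≠ b → c (t a) = 0 ∨ c (t b) = 0)
    {u v : FreeMonoid X} (h : ∀ x, fox t u x = fox t v x) : u = v := by
  have hnn : ∀ (u : FreeMonoid X) (x : X), 0 ≤ c (fox t u x) := by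
    intro u x
    induction u using FreeMonoid.inductionOn' with
    | one => simp
    | of_mul a u ih =>
      rw [fox_of_mul, map_add, map_mul]
      have := mul_nonneg (hc a) ih
      split_ifs <;> simp <;> omega
  have hpos : ∀ (a : X) (u : FreeMonoid X), 0 < c (fox t (of a * u) a) := by
    intro a u
    rw [fox_of_mul, map_add, map_mul, if_pos rfl, map_one]
    have := mul_nonneg (hc a) (hnn u a)
    omega
  have hzero : ∀ (a b : X) (u : FreeMonoid X), a ≠ b → c (t b) = 0 →
      c (fox t (of b * u) a) = 0 := by
    intro a b u hab hb
    rw [fox_of_mul, map_add, map_mul, if_neg (Ne.symm hab), map_zero, hb, zero_mul, add_zero]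
  induction u using FreeMonoid.inductionOn' generalizing v with
  | one =>
    induction v using FreeMonoid.inductionOn' with
    | one => rfl
    | of_mul b v _ =>
      have := hpos b v
      rw [← h b, fox_one, map_zero] at this
      omega
  | of_mul a u ih =>
    induction v using FreeMonoid.inductionOn' with
    | one =>
      have := hpos a u
      rw [h a, fox_one, map_zero] at this
      omega
    | of_mul b v _ =>
      by_cases hab : a = b
      · subst hab
        rw [ih fun x => ?_]
        have hx := h x
        rw [fox_of_mul, fox_of_mul] at hx
        exact mul_left_cancel₀ (ht a) (add_left_cancel hx)
      · exfalso
        rcases hc' a b hab with h0 | h0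
        · have h1 := hzero b a u (Ne.symm hab) h0
          have h2 := hpos b v
          rw [h b] at h1
          omega
        · have h1 := hzero a b v hab h0
          have h2 := hpos a u
          rw [h a] at h2
          omega

theorem fox_const_one (w : FreeMonoid Y) (y : Y) :
    fox (fun _ => (1 : R)) w y = (parikh w y : R) := by
  induction w using FreeMonoid.inductionOn' with
  | one => simp
  | of_mul a w ih =>
    rw [fox_of_mul, ih, one_mul, parikh_mul, parikh_of, Finsupp.add_apply, Finsupp.single_apply]
    push_cast
    rfl

/-- The weights on the letters `x` given by the commutative images of the words `φ x`. -/
noncomputable def imageWeight (φ : FreeMonoid X →* FreeMonoid Y) (x : X) : MvPolynomial Y ℤ :=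
  MvPolynomial.monomial (parikh (φ (of x))) 1

/-- The chain rule for polynomial weights. -/
theorem fox_X_map [Fintype X] (φ : FreeMonoid X →* FreeMonoid Y) (u : FreeMonoid X) (y : Y) :
    fox (MvPolynomial.X : Y → MvPolynomial Y ℤ) (φ u) y =
      ∑ x, fox (imageWeight φ) u x * fox MvPolynomial.X (φ (of x)) y := by
  rw [fox_map]
  simp only [lift_X]
  rfl

theorem eq_of_fox_X_eq {u v : FreeMonoid Y}
    (h : ∀ y, fox (MvPolynomial.X : Y → MvPolynomial Y ℤ) u y = fox MvPolynomial.X v y) :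
    u = v :=
  eq_of_fox_eq MvPolynomial.constantCoeff (fun _ => MvPolynomial.X_ne_zero _) (by simp) (by simp) h

/-- The vector of differences of the Fox derivatives of the two sides of an equation. -/
def foxDiff {n : ℕ} (t : Fin n → R) (E : Equation n) (x : Fin n) : R :=
  fox t E.lhs x - fox t E.rhs x

/-- A morphism solves an equation if and only if its Jacobian kills the vector of Fox derivatives
of the equation. -/
theorem isSolution_iff_foxDiff {n k : ℕ} (φ : FreeMonoid (Fin n) →* FreeMonoid (Fin k))
    (E : Equation n) : E.IsSolution φ ↔
      ∀ y, ∑ x, foxDiff (imageWeight φ) E x * fox MvPolynomial.X (φ (of x)) y = 0 := by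
  have key : ∀ y, ∑ x, foxDiff (imageWeight φ) E x * fox MvPolynomial.X (φ (of x)) y =
      fox MvPolynomial.X (φ E.lhs) y - fox MvPolynomial.X (φ E.rhs) y := by
    intro y
    simp only [foxDiff, sub_mul, Finset.sum_sub_distrib, ← fox_X_map]
  simp only [key, sub_eq_zero]
  exact ⟨fun h y => by rw [show φ E.lhs = φ E.rhs from h], fun h => eq_of_fox_X_eq h⟩

end Fox

/-! ### Full morphisms of corank one -/

/-- The Parikh vectors of all letters but one form a basis. -/
theorem IsFull.exists_linearIndependent {k : ℕ} {φ : FreeMonoid (Fin (k + 1)) →* FreeMonoid (Fin k)}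
    (hφ : IsFull φ) : ∃ (ρ : Fin k → Fin (k + 1)) (w : Fin (k + 1)),
      LinearIndependent ℚ (fun i => parikhQ (φ (of (ρ i)))) ∧ ∀ x, x ≠ w → ∃ i, ρ i = x := by
  classical
  obtain ⟨κ, a, ha, hspan, hli⟩ := exists_linearIndependent' ℚ fun x => parikhQ (φ (of x))
  have : Finite κ := Finite.of_injective a ha
  have := Fintype.ofFinite κ
  have hcard : Fintype.card κ = k := by
    rw [← finrank_span_eq_card hli, hspan, hφ, finrank_top, Module.finrank_fin_fun]
  let e : Fin k ≃ κ := (Fintype.equivFinOfCardEq hcard).symm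
  have hinj : Function.Injective (a ∘ e) := ha.comp e.injective
  have hcompl : (Finset.univ.image (a ∘ e))ᶜ.card = 1 := by
    rw [Finset.card_compl, Finset.card_image_of_injective _ hinj]
    simp
  obtain ⟨w, hw⟩ := Finset.card_eq_one.1 hcompl
  refine ⟨a ∘ e, w, hli.comp e e.injective, fun x hx => ?_⟩
  by_contra hne
  have : x ∈ (Finset.univ.image (a ∘ e))ᶜ := by simpa using hne
  rw [hw, Finset.mem_singleton] at this
  exact hx this

/-- At most one letter is erased by a full morphism of corank one, so a nontrivial equation keeps
a nonzero vector of Fox derivatives. -/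
theorem foxDiff_imageWeight_ne_zero {k : ℕ} {φ : FreeMonoid (Fin (k + 1)) →* FreeMonoid (Fin k)}
    (hφ : IsFull φ) {E : Equation (k + 1)} (hE : ¬ E.IsTrivial) :
    ∃ x, foxDiff (imageWeight φ) E x ≠ 0 := by
  by_contra! h
  obtain ⟨ρ, w, hli, hw⟩ := hφ.exists_linearIndependent
  have hcc : ∀ x, MvPolynomial.constantCoeff (imageWeight φ x) =
      if parikh (φ (of x)) = 0 then 1 else 0 := by
    intro x
    simp [imageWeight, MvPolynomial.constantCoeff_monomial]
  have hne : ∀ x, x ≠ w → MvPolynomial.constantCoeff (imageWeight φ x) = 0 := by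
    intro x hx
    obtain ⟨i, rfl⟩ := hw x hx
    rw [hcc, if_neg]
    intro h0
    refine hli.ne_zero i ?_
    ext y
    simp [parikhQ, h0]
  refine hE (eq_of_fox_eq MvPolynomial.constantCoeff (t := imageWeight φ) (fun x => ?_)
    (fun x => ?_) (fun a b hab => ?_) fun x => sub_eq_zero.1 (h x))
  · simp [imageWeight]
  · rw [hcc]; split_ifs <;> simp
  · by_cases ha : a = w
    · exact Or.inr (hne b fun hb => hab (ha.trans hb.symm))
    · exact Or.inl (hne a ha)

/-- The Jacobian of a full morphism of corank one has corank one, so the vectors of Fox derivatives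
of the equations that the morphism solves are pairwise parallel. -/
theorem foxDiff_parallel {k : ℕ} {φ : FreeMonoid (Fin (k + 1)) →* FreeMonoid (Fin k)}
    (hφ : IsFull φ) {E F : Equation (k + 1)} (hE : E.IsSolution φ) (hF : F.IsSolution φ)
    (x y : Fin (k + 1)) :
    foxDiff (imageWeight φ) E x * foxDiff (imageWeight φ) F y =
      foxDiff (imageWeight φ) E y * foxDiff (imageWeight φ) F x := by
  classical
  obtain ⟨ρ, w, hli, hw⟩ := hφ.exists_linearIndependent
  let J : Fin (k + 1) → Fin k → MvPolynomial (Fin k) ℤ :=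
    fun x y => fox MvPolynomial.X (φ (of x)) y
  let B : Matrix (Fin k) (Fin k) (MvPolynomial (Fin k) ℤ) := Matrix.of fun i y => J (ρ i) y
  -- setting all variables to `1` turns the Jacobian into the matrix of Parikh vectors
  have hdet : B.det ≠ 0 := by
    intro h0
    let f : MvPolynomial (Fin k) ℤ →+* ℚ := MvPolynomial.eval₂Hom (Int.castRingHom ℚ) fun _ => 1
    have h1 : f.mapMatrix B = Matrix.of fun i => parikhQ (φ (of (ρ i))) := by
      ext i y
      have : f (fox MvPolynomial.X (φ (of (ρ i))) y) = parikhQ (φ (of (ρ i))) y := by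
        rw [map_fox]
        simp only [f, MvPolynomial.eval₂Hom_X', fox_const_one]
        rfl
      simpa [B, J] using this
    have h2 : (f.mapMatrix B).det = 0 := by rw [← RingHom.map_det, h0, map_zero]
    have h3 : IsUnit (Matrix.of fun i => parikhQ (φ (of (ρ i)))) :=
      Matrix.linearIndependent_rows_iff_isUnit.1 hli
    rw [Matrix.isUnit_iff_isUnit_det, ← h1, h2] at h3
    exact not_isUnit_zero h3
  have hker : ∀ d : Fin (k + 1) → MvPolynomial (Fin k) ℤ, d w = 0 →
      (∀ y, ∑ x, d x * J x y = 0) → d = 0 := by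
    intro d hd h
    have hinj : Function.Injective ρ := fun i j hij =>
      hli.injective (by simp only [hij])
    have h1 : (fun i => d (ρ i)) = 0 := by
      refine Matrix.eq_zero_of_vecMul_eq_zero hdet ?_
      ext1 y
      rw [Pi.zero_apply, ← h y]
      change ∑ i, d (ρ i) * J (ρ i) y = _
      rw [← Finset.sum_image (g := ρ) (f := fun x => d x * J x y) (fun _ _ _ _ e => hinj e)]
      refine Finset.sum_subset (Finset.subset_univ _) fun x _ hx => ?_
      have : x = w := by
        by_contra hne
        obtain ⟨i, hi⟩ := hw x hne
        exact hx (Finset.mem_image.2 ⟨i, Finset.mem_univ _, hi⟩)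
      rw [this, hd, zero_mul]
    ext1 x
    by_cases hx : x = w
    · rw [hx, hd]; rfl
    · obtain ⟨i, rfl⟩ := hw x hx
      exact congrFun h1 i
  rw [isSolution_iff_foxDiff] at hE hF
  generalize foxDiff (imageWeight φ) E = s at *
  generalize foxDiff (imageWeight φ) F = f at *
  have hcomb : ∀ z, f w * s z = s w * f z := by
    have := hker (fun z => f w * s z - s w * f z) (by ring) (fun y => by
      simp only [sub_mul, Finset.sum_sub_distrib, mul_assoc, ← Finset.mul_sum]
      rw [hE y, hF y]; ring)
    exact fun z => sub_eq_zero.1 (congrFun this z)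
  by_cases hs : s w = 0
  · rw [hker s hs hE]; simp
  · refine mul_left_cancel₀ hs ?_
    linear_combination s y * hcomb x - s x * hcomb y

/-! ### The abelianization of a full morphism -/

/-- The abelianization of `φ`: it maps the Parikh vector of a word `u` to that of `φ u`. -/
noncomputable def abel {X Y : Type*} (φ : FreeMonoid X →* FreeMonoid Y) :
    (X →₀ ℕ) →+ (Y →₀ ℕ) :=
  Finsupp.liftAddHom fun x => multiplesHom _ (parikh (φ (of x)))

theorem abel_apply {X Y : Type*} [Fintype X] (φ : FreeMonoid X →* FreeMonoid Y) (g : X →₀ ℕ) :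
    abel φ g = ∑ x, g x • parikh (φ (of x)) := by
  simp [abel, Finsupp.sum_fintype]

theorem abel_apply_cast {X Y : Type*} [Fintype X] (φ : FreeMonoid X →* FreeMonoid Y)
    (g : X →₀ ℕ) (y : Y) :
    (abel φ g y : ℚ) = ∑ x, (g x : ℚ) * parikhQ (φ (of x)) y := by
  rw [abel_apply, Finsupp.finsetSum_apply]
  simp [parikhQ]

theorem aeval_imageWeight_monomial {X Y : Type*} (φ : FreeMonoid X →* FreeMonoid Y)
    (g : X →₀ ℕ) (a : ℤ) :
    MvPolynomial.aeval (imageWeight φ) (MvPolynomial.monomial g a) =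
      MvPolynomial.monomial (abel φ g) a := by
  have h : abel φ g = g.sum fun x c => c • parikh (φ (of x)) := rfl
  rw [MvPolynomial.aeval_monomial, h, MvPolynomial.monomial_finsupp_sum_index]
  simp [imageWeight, MvPolynomial.monomial_pow, MvPolynomial.algebraMap_eq]

theorem coeff_aeval_imageWeight {X Y : Type*} [DecidableEq Y] (φ : FreeMonoid X →* FreeMonoid Y)
    (M : MvPolynomial X ℤ) (c : Y →₀ ℕ) :
    MvPolynomial.coeff c (MvPolynomial.aeval (imageWeight φ) M) =
      ∑ g ∈ M.support with abel φ g = c, MvPolynomial.coeff g M := by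
  conv_lhs => rw [← MvPolynomial.support_sum_monomial_coeff M, map_sum]
  simp only [aeval_imageWeight_monomial, MvPolynomial.coeff_sum, MvPolynomial.coeff_monomial,
    Finset.sum_filter]

/-- If `abel φ` identifies all vectors that `abel φ'` identifies, then the polynomials vanishing
under `φ'` vanish under `φ`. -/
theorem aeval_imageWeight_eq_zero {X Y : Type*} [DecidableEq Y]
    {φ φ' : FreeMonoid X →* FreeMonoid Y}
    (hker : ∀ g₁ g₂, abel φ' g₁ = abel φ' g₂ → abel φ g₁ = abel φ g₂) {M : MvPolynomial X ℤ}
    (hM : MvPolynomial.aeval (imageWeight φ') M = 0) :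
    MvPolynomial.aeval (imageWeight φ) M = 0 := by
  ext c
  rw [coeff_aeval_imageWeight, MvPolynomial.coeff_zero, Finset.sum_filter,
    ← Finset.sum_fiberwise_of_maps_to (t := M.support.image (abel φ')) (g := abel φ')
      fun g hg => Finset.mem_image_of_mem _ hg]
  refine Finset.sum_eq_zero fun c' hc' => ?_
  obtain ⟨g₀, hg₀, rfl⟩ := Finset.mem_image.1 hc'
  have h1 : ∀ g ∈ M.support.filter (fun g => abel φ' g = abel φ' g₀),
      (if abel φ g = c then MvPolynomial.coeff g M else 0) =
        if abel φ g₀ = c then MvPolynomial.coeff g M else 0 := by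
    intro g hg
    rw [hker g g₀ (Finset.mem_filter.1 hg).2]
  rw [Finset.sum_congr rfl h1]
  split_ifs
  · rw [← coeff_aeval_imageWeight, hM, MvPolynomial.coeff_zero]
  · exact Finset.sum_const_zero

/-- A generic minor of the matrix formed by the Fox derivatives of two equations. -/
noncomputable def foxMinor {n : ℕ} (E F : Equation n) (x y : Fin n) : MvPolynomial (Fin n) ℤ :=
  foxDiff MvPolynomial.X E x * foxDiff MvPolynomial.X F y -
    foxDiff MvPolynomial.X E y * foxDiff MvPolynomial.X F x

theorem aeval_foxMinor {n k : ℕ} (φ : FreeMonoid (Fin n) →* FreeMonoid (Fin k))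
    (E F : Equation n) (x y : Fin n) :
    MvPolynomial.aeval (imageWeight φ) (foxMinor E F x y) =
      foxDiff (imageWeight φ) E x * foxDiff (imageWeight φ) F y -
        foxDiff (imageWeight φ) E y * foxDiff (imageWeight φ) F x := by
  have h : ∀ (E : Equation n) (x : Fin n),
      MvPolynomial.aeval (imageWeight φ)
        (foxDiff (MvPolynomial.X : Fin n → MvPolynomial (Fin n) ℤ) E x) =
        foxDiff (imageWeight φ) E x := by
    intro E x
    have h1 : ∀ u, MvPolynomial.aeval (imageWeight φ)
        (fox (MvPolynomial.X : Fin n → MvPolynomial (Fin n) ℤ) u x) =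
        fox (imageWeight φ) u x := by
      intro u
      have := map_fox (MvPolynomial.aeval (R := ℤ) (imageWeight φ)).toRingHom MvPolynomial.X u x
      simpa using this
    simp only [foxDiff, map_sub, h1]
  simp only [foxMinor, map_sub, map_mul, h]

theorem aeval_foxMinor_eq_zero {k : ℕ} {φ : FreeMonoid (Fin (k + 1)) →* FreeMonoid (Fin k)}
    (hφ : IsFull φ) {E F : Equation (k + 1)} (hE : E.IsSolution φ) (hF : F.IsSolution φ)
    (x y : Fin (k + 1)) : MvPolynomial.aeval (imageWeight φ) (foxMinor E F x y) = 0 := by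
  rw [aeval_foxMinor, foxDiff_parallel hφ hE hF x y, sub_self]

/-- If the Fox derivatives of `E` and `F` become parallel under a solution `φ` of the nontrivial
equation `E`, then `φ` solves `F`, since its Jacobian kills a nonzero multiple of the vector of
derivatives of `F`. -/
theorem isSolution_of_aeval_foxMinor {k : ℕ}
    {φ : FreeMonoid (Fin (k + 1)) →* FreeMonoid (Fin k)} (hφ : IsFull φ) {E F : Equation (k + 1)}
    (hE : ¬ E.IsTrivial) (hs : E.IsSolution φ)
    (h : ∀ x y, MvPolynomial.aeval (imageWeight φ) (foxMinor E F x y) = 0) : F.IsSolution φ := by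
  obtain ⟨x, hx⟩ := foxDiff_imageWeight_ne_zero hφ hE
  rw [isSolution_iff_foxDiff] at hs ⊢
  intro y
  refine (mul_eq_zero.1 ?_).resolve_left hx
  have hpar : ∀ z, foxDiff (imageWeight φ) E x * foxDiff (imageWeight φ) F z =
      foxDiff (imageWeight φ) F x * foxDiff (imageWeight φ) E z := by
    intro z
    have := h x z
    rw [aeval_foxMinor, sub_eq_zero] at this
    rw [this, mul_comm]
  simp only [Finset.mul_sum, ← mul_assoc, hpar]
  simp only [mul_assoc, ← Finset.mul_sum]
  rw [hs y, mul_zero]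

/-- Among the full solutions of a nontrivial equation `E`, the kernel of the abelianization decides
which further equations are solved. -/
theorem isSolution_of_abel {k : ℕ} {φ φ' : FreeMonoid (Fin (k + 1)) →* FreeMonoid (Fin k)}
    (hφ : IsFull φ) (hφ' : IsFull φ') {E F : Equation (k + 1)} (hE : ¬ E.IsTrivial)
    (hs : E.IsSolution φ) (hs' : E.IsSolution φ') (hF : F.IsSolution φ')
    (hker : ∀ g₁ g₂, abel φ' g₁ = abel φ' g₂ → abel φ g₁ = abel φ g₂) : F.IsSolution φ :=
  isSolution_of_aeval_foxMinor hφ hE hs fun x y =>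
    aeval_imageWeight_eq_zero hker (aeval_foxMinor_eq_zero hφ' hs' hF x y)

/-- The space of lengths compatible with `φ` is the annihilator of the kernel of `abel φ`. -/
theorem abel_eq_of_range_lengthMap_le {X Y : Type*} [Fintype X] [Fintype Y] [DecidableEq Y]
    {φ φ' : FreeMonoid X →* FreeMonoid Y}
    (hle : LinearMap.range (lengthMap φ) ≤ LinearMap.range (lengthMap φ')) (g₁ g₂ : X →₀ ℕ)
    (h : abel φ' g₁ = abel φ' g₂) : abel φ g₁ = abel φ g₂ := by
  have key : ∀ (φ : FreeMonoid X →* FreeMonoid Y) (g : X →₀ ℕ) (ℓ : Y → ℚ),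
      ∑ x, (g x : ℚ) * lengthMap φ ℓ x = ∑ y, (abel φ g y : ℚ) * ℓ y := by
    intro φ g ℓ
    simp only [lengthMap_apply, abel_apply_cast, Finset.mul_sum, Finset.sum_mul]
    rw [Finset.sum_comm]
    simp only [mul_assoc]
  ext y
  obtain ⟨ℓ, hℓ⟩ := hle ⟨Pi.single y 1, rfl⟩
  have h1 := key φ g₁ (Pi.single y 1)
  have h2 := key φ g₂ (Pi.single y 1)
  rw [← hℓ, key, h] at h1
  rw [← hℓ, key, h1] at h2
  simpa [Pi.single_apply] using h2

/-- In corank one the kernel of the abelianization is one-dimensional, so it is determined by a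
single pair of distinct vectors that the abelianization identifies. -/
theorem abel_eq_of_common {k : ℕ} {φ φ' : FreeMonoid (Fin (k + 1)) →* FreeMonoid (Fin k)}
    (hφ' : IsFull φ') {g g' : Fin (k + 1) →₀ ℕ} (hne : g ≠ g') (h : abel φ g = abel φ g')
    (h' : abel φ' g = abel φ' g') (g₁ g₂ : Fin (k + 1) →₀ ℕ) (h12 : abel φ' g₁ = abel φ' g₂) :
    abel φ g₁ = abel φ g₂ := by
  let A : (FreeMonoid (Fin (k + 1)) →* FreeMonoid (Fin k)) → (Fin (k + 1) → ℚ) →ₗ[ℚ] (Fin k → ℚ) :=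
    fun φ => Fintype.linearCombination ℚ fun x => parikhQ (φ (of x))
  let q : (Fin (k + 1) →₀ ℕ) → Fin (k + 1) → ℚ := fun g x => g x
  have hA : ∀ φ g g', abel φ g = abel φ g' ↔ A φ (q g - q g') = 0 := by
    intro φ g g'
    have h1 : ∀ g, A φ (q g) = fun y => (abel φ g y : ℚ) := by
      intro g
      ext y
      rw [abel_apply_cast]
      simp [A, q, Fintype.linearCombination_apply]
    rw [map_sub, sub_eq_zero, h1, h1]
    constructor
    · intro h; rw [h]
    · intro h; ext y; exact_mod_cast congrFun h y
  rw [hA] at h h' h12 ⊢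
  have hrank : Module.finrank ℚ (LinearMap.ker (A φ')) = 1 := by
    have h1 := LinearMap.finrank_range_add_finrank_ker (A φ')
    have h2 : LinearMap.range (A φ') = ⊤ := by
      rw [Fintype.range_linearCombination]; exact hφ'
    rw [h2, finrank_top, Module.finrank_fin_fun, Module.finrank_fin_fun] at h1
    omega
  have hd : (⟨q g - q g', h'⟩ : LinearMap.ker (A φ')) ≠ 0 := by
    intro h0
    have h1 : q g - q g' = 0 := congrArg Subtype.val h0
    refine hne (Finsupp.ext fun x => ?_)
    have h2 : (g x : ℚ) = g' x := congrFun (sub_eq_zero.1 h1) x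
    exact_mod_cast h2
  obtain ⟨c, hc⟩ := (finrank_eq_one_iff_of_nonzero' _ hd).1 hrank ⟨q g₁ - q g₂, h12⟩
  have hc' : c • (q g - q g') = q g₁ - q g₂ := congrArg Subtype.val hc
  rw [← hc', map_smul, h, smul_zero]

/-! ### Counting kernels by extremal exponents -/

/-- Among the exponents of `M`, `g` has the least degree after applying `κ`, it carries a positive
coefficient, and it has the least degree among the exponents with positive coefficient and the same
image under `κ`. -/
structure IsExtremal {X Y : Type*} (M : MvPolynomial X ℤ) (κ : (X →₀ ℕ) →+ (Y →₀ ℕ))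
    (g : X →₀ ℕ) : Prop where
  pos : 0 < M.coeff g
  degree_le : ∀ g', M.coeff g' ≠ 0 → (κ g).degree ≤ (κ g').degree
  degree_le_of_eq : ∀ g', 0 < M.coeff g' → κ g' = κ g → g.degree ≤ g'.degree

/-- Two comparable extremal exponents, for possibly different maps, are equal. -/
theorem IsExtremal.eq_of_le {X Y : Type*} {M : MvPolynomial X ℤ} {κ κ' : (X →₀ ℕ) →+ (Y →₀ ℕ)}
    {g g' : X →₀ ℕ} (h : IsExtremal M κ g) (h' : IsExtremal M κ' g') (hle : g ≤ g') : g = g' := by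
  obtain ⟨d, rfl⟩ := exists_add_of_le hle
  have h1 := h'.degree_le g h.pos.ne'
  rw [map_add, map_add] at h1
  have h2 : κ' d = 0 := (Finsupp.degree_eq_zero_iff _).1 (by omega)
  have h3 := h'.degree_le_of_eq g h.pos (by rw [map_add, h2, add_zero])
  rw [map_add] at h3
  have h4 : d = 0 := (Finsupp.degree_eq_zero_iff _).1 (by omega)
  rw [h4, add_zero]

/-- If `M` vanishes under `κ`, then the fibre of `κ` over an image of least degree contains both
positive and negative coefficients. -/
theorem exists_isExtremal {X Y : Type*} [DecidableEq Y] {M : MvPolynomial X ℤ} (hM : M ≠ 0)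
    {κ : (X →₀ ℕ) →+ (Y →₀ ℕ)}
    (hκ : ∀ c, ∑ g ∈ M.support with κ g = c, M.coeff g = 0) :
    ∃ g g', IsExtremal M κ g ∧ IsExtremal (-M) κ g' ∧ κ g = κ g' := by
  obtain ⟨g₀, hg₀, hmin⟩ := M.support.exists_min_image (fun g => (κ g).degree)
    (MvPolynomial.support_nonempty.2 hM)
  have hmin' : ∀ g', M.coeff g' ≠ 0 → (κ g₀).degree ≤ (κ g').degree :=
    fun g' hg' => hmin g' (MvPolynomial.mem_support_iff.2 hg')
  let s := M.support.filter fun g => κ g = κ g₀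
  have hmem : ∀ g, g ∈ s ↔ M.coeff g ≠ 0 ∧ κ g = κ g₀ := by
    intro g; simp [s]
  have h0 : g₀ ∈ s := (hmem _).2 ⟨MvPolynomial.mem_support_iff.1 hg₀, rfl⟩
  have hpos : (s.filter fun g => 0 < M.coeff g).Nonempty := by
    obtain ⟨g, hg, hgp⟩ := Finset.exists_pos_of_sum_zero_of_exists_nonzero _ (hκ (κ g₀))
      ⟨g₀, h0, ((hmem _).1 h0).1⟩
    exact ⟨g, Finset.mem_filter.2 ⟨hg, hgp⟩⟩
  have hneg : (s.filter fun g => 0 < (-M).coeff g).Nonempty := by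
    have hsum : ∑ g ∈ s, (-M).coeff g = 0 := by
      simp only [MvPolynomial.coeff_neg, Finset.sum_neg_distrib]
      rw [neg_eq_zero]
      exact hκ (κ g₀)
    obtain ⟨g, hg, hgp⟩ := Finset.exists_pos_of_sum_zero_of_exists_nonzero _ hsum
      ⟨g₀, h0, by simpa using ((hmem _).1 h0).1⟩
    exact ⟨g, Finset.mem_filter.2 ⟨hg, hgp⟩⟩
  obtain ⟨g, hg, hgmin⟩ := Finset.exists_min_image _ Finsupp.degree hpos
  obtain ⟨g', hg', hgmin'⟩ := Finset.exists_min_image _ Finsupp.degree hneg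
  rw [Finset.mem_filter, hmem] at hg hg'
  refine ⟨g, g', ⟨hg.2, fun a ha => ?_, fun a ha hag => ?_⟩,
    ⟨hg'.2, fun a ha => ?_, fun a ha hag => ?_⟩, hg.1.2.trans hg'.1.2.symm⟩
  · rw [hg.1.2]; exact hmin' a ha
  · exact hgmin a (Finset.mem_filter.2 ⟨(hmem a).2 ⟨ha.ne', hag.trans hg.1.2⟩, ha⟩)
  · rw [hg'.1.2]; exact hmin' a (by simpa using ha)
  · exact hgmin' a (Finset.mem_filter.2
      ⟨(hmem a).2 ⟨by simpa using ha.ne', hag.trans hg'.1.2⟩, ha⟩)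

/-- A nonzero polynomial whose exponents with positive coefficient, as well as those with negative
coefficient, are covered by `p` chains vanishes under at most `p ^ 2` maps with essentially
different kernels: each map singles out one exponent of either sign, each chain contains at most one
of the exponents singled out, and the pair of exponents determines the map. -/
theorem card_le_sq_of_chains {I P X Y : Type*} [Fintype I] [Fintype P] [DecidableEq Y]
    {M : MvPolynomial X ℤ} (hM : M ≠ 0) (κ : I → (X →₀ ℕ) →+ (Y →₀ ℕ))
    (hκ : ∀ i c, ∑ g ∈ M.support with κ i g = c, M.coeff g = 0)
    (C C' : P → Set (X →₀ ℕ)) (hC : ∀ p, IsChain (· ≤ ·) (C p))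
    (hC' : ∀ p, IsChain (· ≤ ·) (C' p)) (hcov : ∀ g, 0 < M.coeff g → ∃ p, g ∈ C p)
    (hcov' : ∀ g, 0 < (-M).coeff g → ∃ p, g ∈ C' p)
    (hinj : ∀ i j, i ≠ j → ∀ g g', κ i g = κ i g' → κ j g = κ j g' → g = g') :
    Fintype.card I ≤ Fintype.card P ^ 2 := by
  choose g g' hg hg' hgg' using fun i => exists_isExtremal hM (hκ i)
  choose p hp using fun i => hcov (g i) (hg i).pos
  choose p' hp' using fun i => hcov' (g' i) (hg' i).pos
  have huniq : ∀ (M : MvPolynomial X ℤ) (D : Set (X →₀ ℕ)), IsChain (· ≤ ·) D →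
      ∀ i j a b, IsExtremal M (κ i) a → IsExtremal M (κ j) b → a ∈ D → b ∈ D → a = b := by
    intro M D hD i j a b ha hb haD hbD
    rcases hD.total haD hbD with h | h
    · exact ha.eq_of_le hb h
    · exact (hb.eq_of_le ha h).symm
  have hf : Function.Injective fun i => (p i, p' i) := by
    intro i j hij
    by_contra hne
    rw [Prod.mk.injEq] at hij
    have h1 : g i = g j :=
      huniq M _ (hC (p i)) i j _ _ (hg i) (hg j) (hp i) (by rw [hij.1]; exact hp j)
    have h2 : g' i = g' j :=
      huniq (-M) _ (hC' (p' i)) i j _ _ (hg' i) (hg' j) (hp' i) (by rw [hij.2]; exact hp' j)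
    have h3 := hinj i j hne (g i) (g' i) (hgg' i) (by rw [h1, h2]; exact hgg' j)
    have h4 := (hg i).pos
    have h5 := (hg' i).pos
    rw [← h3, MvPolynomial.coeff_neg] at h5
    omega
  calc Fintype.card I ≤ Fintype.card (P × P) := Fintype.card_le_of_injective _ hf
    _ = Fintype.card P ^ 2 := by rw [Fintype.card_prod, sq]

/-! ### The exponents of a minor of Fox derivatives -/

/-- The Parikh vectors of the prefixes of a word. -/
def prefixVectors {X : Type*} (u : FreeMonoid X) : Set (X →₀ ℕ) :=
  {g | ∃ i, g = parikh (ofList (u.toList.take i))}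

theorem isChain_prefixVectors {X : Type*} (u : FreeMonoid X) :
    IsChain (· ≤ ·) (prefixVectors u) := by
  have hmono : ∀ i j, i ≤ j →
      parikh (ofList (u.toList.take i)) ≤ parikh (ofList (u.toList.take j)) := by
    intro i j hij
    obtain ⟨l, hl⟩ := List.take_prefix_take_left (l := u.toList) hij
    rw [← hl, ofList_append, parikh_mul]
    exact le_self_add
  rintro _ ⟨i, rfl⟩ _ ⟨j, rfl⟩ -
  rcases le_total i j with h | h
  · exact Or.inl (hmono i j h)
  · exact Or.inr (hmono j i h)

theorem isChain_add {X : Type*} {D : Set (X →₀ ℕ)} (hD : IsChain (· ≤ ·) D) (k : X →₀ ℕ) :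
    IsChain (· ≤ ·) ((fun l => k + l) '' D) := by
  rintro _ ⟨a, ha, rfl⟩ _ ⟨b, hb, rfl⟩ -
  rcases hD.total ha hb with h | h
  · exact Or.inl (add_le_add_right h k)
  · exact Or.inr (add_le_add_right h k)

theorem coeff_mul_nonneg_of_nonneg {X : Type*} {p q : MvPolynomial X ℤ} (hp : ∀ g, 0 ≤ p.coeff g)
    (hq : ∀ g, 0 ≤ q.coeff g) (g : X →₀ ℕ) : 0 ≤ (p * q).coeff g := by
  classical
  rw [MvPolynomial.coeff_mul]
  exact Finset.sum_nonneg fun c _ => mul_nonneg (hp _) (hq _)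

theorem coeff_fox_X_nonneg {X : Type*} [DecidableEq X] (u : FreeMonoid X) (x : X) (g : X →₀ ℕ) :
    0 ≤ (fox (MvPolynomial.X : X → MvPolynomial X ℤ) u x).coeff g := by
  induction u using FreeMonoid.inductionOn' generalizing g with
  | one => simp
  | of_mul a u ih =>
    rw [fox_of_mul, MvPolynomial.coeff_add]
    refine add_nonneg ?_ (coeff_mul_nonneg_of_nonneg (fun g => ?_) ih g)
    · split_ifs
      · rw [MvPolynomial.coeff_one]; split_ifs <;> simp
      · simp
    · rw [MvPolynomial.coeff_X]; split_ifs <;> simp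

/-- The exponents in a Fox derivative with respect to `x` are the Parikh vectors of the prefixes
preceding the occurrences of `x`. -/
theorem exists_of_coeff_fox_X_ne_zero {X : Type*} [DecidableEq X] {u : FreeMonoid X} {x : X}
    {g : X →₀ ℕ} (h : (fox (MvPolynomial.X : X → MvPolynomial X ℤ) u x).coeff g ≠ 0) :
    ∃ i : Fin u.toList.length, u.toList[i] = x ∧ g = parikh (ofList (u.toList.take i)) := by
  induction u using FreeMonoid.inductionOn' generalizing g with
  | one => simp at h
  | of_mul a u ih =>
    rw [fox_of_mul, MvPolynomial.coeff_add] at h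
    by_cases h1 : (MvPolynomial.X a * fox (MvPolynomial.X : X → MvPolynomial X ℤ) u x).coeff g = 0
    · rw [h1, add_zero] at h
      refine ⟨⟨0, Nat.succ_pos _⟩, ?_⟩
      split_ifs at h with hax
      · refine ⟨hax, ?_⟩
        rw [MvPolynomial.coeff_one] at h
        simpa [eq_comm] using h
      · simp at h
    · rw [MvPolynomial.coeff_X_mul'] at h1
      split_ifs at h1 with hg
      · obtain ⟨i, hi, hgi⟩ := ih h1
        refine ⟨⟨i + 1, Nat.succ_lt_succ i.2⟩, hi, ?_⟩
        have h2 : Finsupp.single a 1 ≤ g := by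
          rw [Finsupp.single_le_iff]
          exact Nat.one_le_iff_ne_zero.2 (Finsupp.mem_support_iff.1 hg)
        rw [← add_tsub_cancel_of_le h2, hgi]
        change _ = parikh (of a * ofList (u.toList.take i))
        rw [parikh_mul, parikh_of]
      · exact absurd rfl h1

/-- A chain containing the exponents of the minor of `E` and `F` for the letters `x`, `y` that
arise, with positive sign, from a given position of `E` carrying `x` or `y`. The letter at that
position and the side of `E` on which it lies decide which side of `F` contributes the other
factor; a letter other than `x` is treated as `y`. -/
def minorChain {n : ℕ} (E F : Equation n) (x : Fin n) :
    Fin E.lhs.toList.length ⊕ Fin E.rhs.toList.length → Set (Fin n →₀ ℕ)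
  | Sum.inl i => (fun l => parikh (ofList (E.lhs.toList.take i)) + l) ''
      prefixVectors (if E.lhs.toList[i] = x then F.lhs else F.rhs)
  | Sum.inr i => (fun l => parikh (ofList (E.rhs.toList.take i)) + l) ''
      prefixVectors (if E.rhs.toList[i] = x then F.rhs else F.lhs)

theorem isChain_minorChain {n : ℕ} (E F : Equation n) (x : Fin n)
    (p : Fin E.lhs.toList.length ⊕ Fin E.rhs.toList.length) :
    IsChain (· ≤ ·) (minorChain E F x p) := by
  rcases p with i | i <;> exact isChain_add (isChain_prefixVectors _) _

theorem exists_mem_minorChain {n : ℕ} {E F : Equation n} {x y : Fin n} (hxy : y ≠ x)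
    {g : Fin n →₀ ℕ} (hg : 0 < (foxMinor E F x y).coeff g) : ∃ p, g ∈ minorChain E F x p := by
  let D : FreeMonoid (Fin n) → Fin n → MvPolynomial (Fin n) ℤ := fox MvPolynomial.X
  have hdecomp : foxMinor E F x y =
      (D E.lhs x * D F.lhs y + D E.rhs x * D F.rhs y + D E.lhs y * D F.rhs x +
        D E.rhs y * D F.lhs x) -
      (D E.lhs x * D F.rhs y + D E.rhs x * D F.lhs y + D E.lhs y * D F.lhs x +
        D E.rhs y * D F.rhs x) := by
    simp only [foxMinor, foxDiff, D]
    ring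
  have hnn : ∀ u v a b, 0 ≤ (D u a * D v b).coeff g := fun u v a b =>
    coeff_mul_nonneg_of_nonneg (coeff_fox_X_nonneg u a) (coeff_fox_X_nonneg v b) g
  have hsplit : ∀ u v a b, (D u a * D v b).coeff g ≠ 0 →
      ∃ i : Fin u.toList.length, u.toList[i] = a ∧
        g ∈ (fun l => parikh (ofList (u.toList.take i)) + l) '' prefixVectors v := by
    intro u v a b h
    rw [MvPolynomial.coeff_mul] at h
    obtain ⟨⟨k, l⟩, hkl, hne⟩ := Finset.exists_ne_zero_of_sum_ne_zero h
    obtain ⟨i, hi, rfl⟩ := exists_of_coeff_fox_X_ne_zero (left_ne_zero_of_mul hne)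
    obtain ⟨j, -, hj⟩ := exists_of_coeff_fox_X_ne_zero (right_ne_zero_of_mul hne)
    exact ⟨i, hi, l, ⟨j, hj⟩, Finset.HasAntidiagonal.mem_antidiagonal.1 hkl⟩
  rw [hdecomp, MvPolynomial.coeff_sub] at hg
  simp only [MvPolynomial.coeff_add] at hg
  have n1 := hnn E.lhs F.rhs x y
  have n2 := hnn E.rhs F.lhs x y
  have n3 := hnn E.lhs F.lhs y x
  have n4 := hnn E.rhs F.rhs y x
  by_cases h1 : (D E.lhs x * D F.lhs y).coeff g = 0
  · by_cases h2 : (D E.rhs x * D F.rhs y).coeff g = 0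
    · by_cases h3 : (D E.lhs y * D F.rhs x).coeff g = 0
      · by_cases h4 : (D E.rhs y * D F.lhs x).coeff g = 0
        · omega
        · obtain ⟨i, hi, h⟩ := hsplit _ _ _ _ h4
          exact ⟨Sum.inr i, by simpa only [minorChain, hi, if_neg hxy] using h⟩
      · obtain ⟨i, hi, h⟩ := hsplit _ _ _ _ h3
        exact ⟨Sum.inl i, by simpa only [minorChain, hi, if_neg hxy] using h⟩
    · obtain ⟨i, hi, h⟩ := hsplit _ _ _ _ h2
      exact ⟨Sum.inr i, by simpa only [minorChain, hi, if_true] using h⟩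
  · obtain ⟨i, hi, h⟩ := hsplit _ _ _ _ h1
    exact ⟨Sum.inl i, by simpa only [minorChain, hi, if_true] using h⟩

/-- Full common solutions of `E` and `F` with pairwise different kernels are at most `|E| ^ 2` in
number, if some full solution of `E` does not solve `F`. -/
theorem card_le_length_sq {k : ℕ} {I : Type*} [Fintype I] {E F : Equation (k + 1)}
    (hE : ¬ E.IsTrivial) {φ₀ : FreeMonoid (Fin (k + 1)) →* FreeMonoid (Fin k)} (hφ₀ : IsFull φ₀)
    (hE₀ : E.IsSolution φ₀) (hF₀ : ¬ F.IsSolution φ₀)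
    (φ : I → FreeMonoid (Fin (k + 1)) →* FreeMonoid (Fin k)) (hφ : ∀ i, IsFull (φ i))
    (hEφ : ∀ i, E.IsSolution (φ i)) (hFφ : ∀ i, F.IsSolution (φ i))
    (hinj : ∀ i j, i ≠ j → ∀ g g', abel (φ i) g = abel (φ i) g' →
      abel (φ j) g = abel (φ j) g' → g = g') :
    Fintype.card I ≤ E.length ^ 2 := by
  -- the Fox derivatives of `E` and `F` are not generically parallel
  obtain ⟨x, y, hM⟩ : ∃ x y, foxMinor E F x y ≠ 0 := by
    by_contra! h
    exact hF₀ (isSolution_of_aeval_foxMinor hφ₀ hE hE₀ fun x y => by rw [h, map_zero])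
  have hyx : y ≠ x := by
    rintro rfl
    exact hM (sub_self _)
  have hswap : -foxMinor E F x y = foxMinor E ⟨F.rhs, F.lhs⟩ x y := by
    simp only [foxMinor, foxDiff]
    ring
  have hcard : Fintype.card (Fin E.lhs.toList.length ⊕ Fin E.rhs.toList.length) = E.length := by
    simp [Equation.length, FreeMonoid.length]
  rw [← hcard]
  refine card_le_sq_of_chains hM (fun i => abel (φ i)) (fun i c => ?_) (minorChain E F x)
    (minorChain E ⟨F.rhs, F.lhs⟩ x) (isChain_minorChain _ _ _) (isChain_minorChain _ _ _)
    (fun g hg => exists_mem_minorChain hyx hg) (fun g hg => ?_) hinj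
  · rw [← coeff_aeval_imageWeight, aeval_foxMinor_eq_zero (hφ i) (hEφ i) (hFφ i),
      MvPolynomial.coeff_zero]
  · rw [hswap] at hg
    exact exists_mem_minorChain hyx hg

end WordEq

open WordEq in
theorem mainTheorem2 {α : Type*} (n m : ℕ) (hm : 1 ≤ m)
    (E : Fin m → WordEq.Equation n)
    (hnontriv : ∀ i, ¬ (E i).IsTrivial)
    (hcommon : ∃ h : FreeMonoid (Fin n) →* FreeMonoid α,
      WordEq.rank h + 1 = n ∧ ∀ i, (E i).IsSolution h)
    (hchain : ∀ (i : ℕ) (hi : i + 1 < m), ∃ h : FreeMonoid (Fin n) →* FreeMonoid α,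
      WordEq.rank h + 1 = n ∧ (∀ j : Fin m, (j : ℕ) ≤ i → (E j).IsSolution h) ∧
        ¬ (E ⟨i + 1, hi⟩).IsSolution h) :
    (∀ (h2 : 2 ≤ m) (N : ℕ) (V : Fin N → Submodule ℚ (Fin n → ℚ)),
      (∀ k, Module.finrank ℚ (V k) + 1 = n) →
      (∀ h : FreeMonoid (Fin n) →* FreeMonoid α, WordEq.rank h + 1 = n →
        (E ⟨0, hm⟩).IsSolution h → (E ⟨1, h2⟩).IsSolution h →
        ∃ k, WordEq.lengthType h ∈ V k) →
      m ≤ N + 1) ∧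
    m ≤ (E ⟨0, hm⟩).length ^ 2 + 1 := by
  obtain ⟨h₀, hr₀, hs₀⟩ := hcommon
  obtain ⟨k, rfl⟩ : ∃ k, n = k + 1 := ⟨rank h₀, hr₀.symm⟩
  obtain ⟨a⟩ := exists_embedding_of_rank (Nat.succ_injective hr₀)
  -- the common solution closes the chain of solutions
  have hφ : ∀ i : Fin m, ∃ φ : FreeMonoid (Fin (k + 1)) →* FreeMonoid (Fin k), IsFull φ ∧
      (∀ j ≤ i, (E j).IsSolution φ) ∧ ∀ hi : (i : ℕ) + 1 < m, ¬ (E ⟨i + 1, hi⟩).IsSolution φ := by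
    intro i
    by_cases hi : (i : ℕ) + 1 < m
    · obtain ⟨h, hr, hs, hns⟩ := hchain i hi
      obtain ⟨φ, hφ, hiff⟩ := exists_full_equivalent (Nat.succ_injective hr) (hnontriv i)
        (hs i le_rfl)
      exact ⟨φ, hφ, fun j hj => (hiff _).2 (hs j hj), fun _ => mt (hiff _).1 hns⟩
    · obtain ⟨φ, hφ, hiff⟩ := exists_full_equivalent (Nat.succ_injective hr₀) (hnontriv i) (hs₀ i)
      exact ⟨φ, hφ, fun j _ => (hiff _).2 (hs₀ j), fun h => absurd h hi⟩
  choose φ hfull hsol hnsol using hφ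
  have hzero : ∀ i, (E ⟨0, hm⟩).IsSolution (φ i) :=
    fun i => hsol i _ (Fin.mk_le_of_le_val i.1.zero_le)
  -- solutions at different places of the chain have different kernels
  have hker : ∀ i j, i < j →
      ¬ ∀ g₁ g₂, abel (φ j) g₁ = abel (φ j) g₂ → abel (φ i) g₁ = abel (φ i) g₂ := by
    intro i j hij hk
    have hi : (i : ℕ) + 1 < m := by have := j.2; have : (i : ℕ) < j := hij; omega
    exact hnsol i hi (isSolution_of_abel (hfull i) (hfull j) (hnontriv ⟨0, hm⟩) (hzero i) (hzero j)
      (hsol j ⟨i + 1, hi⟩ hij) hk)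
  constructor
  · intro h2 N V hV hcover
    have hone : ∀ i : Fin (m - 1), (i : ℕ) + 1 < m := fun i => by omega
    have hrange : ∀ i : Fin (m - 1), ∃ c,
        LinearMap.range (lengthMap (φ ⟨i + 1, hone i⟩)) = V c := by
      intro i
      refine exists_range_lengthMap_eq (hfull _) a.injective V
        (fun c => Nat.succ_injective (hV c)) fun θ hθ => hcover _ (by rw [hθ]) ?_ ?_
      · have h1 : (E ⟨0, hm⟩).IsSolution (φ ⟨i + 1, hone i⟩) := hzero _
        exact congrArg θ h1
      · have h1 : (E ⟨1, h2⟩).IsSolution (φ ⟨i + 1, hone i⟩) :=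
          hsol _ _ (Fin.mk_le_mk.2 (by omega))
        exact congrArg θ h1
    choose c hc using hrange
    have hcinj : Function.Injective c := by
      intro i j hij
      by_contra hne
      have key : ∀ i j : Fin (m - 1), i < j → c i ≠ c j := by
        intro i j hlt hij
        refine hker ⟨i + 1, hone i⟩ ⟨j + 1, hone j⟩ (Fin.mk_lt_mk.2 (Nat.succ_lt_succ hlt))
          (abel_eq_of_range_lengthMap_le ?_)
        rw [hc, hc, hij]
      rcases lt_or_gt_of_ne hne with h | h
      · exact key i j h hij
      · exact key j i h hij.symm
    have := Fintype.card_le_of_injective c hcinj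
    rw [Fintype.card_fin, Fintype.card_fin] at this
    omega
  · by_cases h2 : 2 ≤ m
    · have hone : ∀ i : Fin (m - 1), (i : ℕ) + 1 < m := fun i => by omega
      have := card_le_length_sq (I := Fin (m - 1)) (hnontriv ⟨0, hm⟩) (hfull ⟨0, hm⟩) (hzero _)
        (hnsol ⟨0, hm⟩ h2) (fun i => φ ⟨i + 1, hone i⟩) (fun i => hfull _) (fun i => hzero _)
        (fun i => hsol _ _ (Fin.mk_le_mk.2 (by simp))) (by
          have key : ∀ i j : Fin (m - 1), i < j → ∀ g g',
              abel (φ ⟨i + 1, hone i⟩) g = abel (φ ⟨i + 1, hone i⟩) g' →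
              abel (φ ⟨j + 1, hone j⟩) g = abel (φ ⟨j + 1, hone j⟩) g' → g = g' := by
            intro i j hlt g g' h h'
            by_contra hne
            exact hker ⟨i + 1, hone i⟩ ⟨j + 1, hone j⟩ (Fin.mk_lt_mk.2 (Nat.succ_lt_succ hlt))
              (abel_eq_of_common (hfull _) hne h h')
          intro i j hne g g' h h'
          rcases lt_or_gt_of_ne hne with hlt | hlt
          · exact key i j hlt g g' h h'
          · exact key j i hlt g g' h' h)
      rw [Fintype.card_fin] at this
      omega
    · omega
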